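/- A zigzag persistence module $V$ over a field $\mathbb F$ is a family of $\mathbb F$-vector spaces $(V_i)_{i\in\mathbb Z}$ together with, for every $i\in\mathbb Z$, one linear map between $V_i$ and $V_{i+1}$, either $V_i\to V_{i+1}$ or $V_{i+1}\to V_i$, the directions being prescribed arbitrarily. (For instance, in the alternating case $\cdots\rightarrow V_{-1}\leftarrow V_0\rightarrow V_1\leftarrow\cdots$ all even indices are sources and all odd indices are sinks.) It is locally finite-dimensional if $\dim_{\mathbb F}V_i<\infty$ for all $i$, and non-zero if $V_i\neq 0$ for some $i$. For $a\le b$ in $\mathbb Z\cup\{\pm\infty\}$ with $a\neq+\infty$ and $b\neq-\infty$, the interval persistence module $I^{[a,b]}$ (with the same prescribed directions) has $I^{[a,b]}_i=\mathbb F$ if $a\le i\le b$ and $I^{[a,b]}_i=0$ otherwise; its maps between two non-zero spaces are the identity, and all its other maps are zero. Isomorphisms are families of linear isomorphisms commuting with all structure maps, and direct sums are formed index by index. \textbf{Theorem.} Let $V$ be a non-zero locally finite-dimensional zigzag persistence module over $\mathbb F$. Then there are a non-empty, possibly infinite, index set $J$ and, for every $j\in J$, elements $a_j\le b_j$ of $\mathbb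 Z\cup\{\pm\infty\}$ with $a_j\neq+\infty$ and $b_j\neq-\infty$, such that $$V\;\cong\;\bigoplus_{j\in J} I^{[a_j,b_j]}.$$ -/

import Mathlib

universe u v w

/-- An orientation of the edges `i — i + 1` (`i : ℤ`) of the two-sided infinite line:
`o i = true` means that the arrow points from `i` to `i + 1`,
`o i = false` means that it points from `i + 1` to `i`.
The alternating zigzag (sources at the even integers, sinks at the odd ones) is
`fun i => decide (Even i)`. -/
abbrev ZigzagOrientation : Type := ℤ → Bool

/-- A zigzag persistence module of shape `o` over `𝔽`: a sequence of vector spaces indexed by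
the integers, and for each `i` one linear map between the spaces at `i` and `i + 1`, in the
direction that `o` prescribes. For the alternating orientation, `fwd i` is the map
`f_i : V_i → V_{i+1}` (`i` even) and `bwd i` is the map `g_{i+1} : V_{i+1} → V_i` (`i` odd).
No two of the arrows compose in a way that imposes a relation, so this is the same as a functor
to vector spaces from the path category of the oriented line. -/
structure ZigzagModule (𝔽 : Type u) [Field 𝔽] (o : ZigzagOrientation) where
  obj : ℤ → Type v
  [addCommGroup : ∀ i, AddCommGroup (obj i)]
  [module : ∀ i, Module 𝔽 (obj i)]
  fwd : ∀ i, o i = true → (obj i →ₗ[𝔽] obj (i + 1))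
  bwd : ∀ i, o i = false → (obj (i + 1) →ₗ[𝔽] obj i)

namespace ZigzagModule

attribute [instance] ZigzagModule.addCommGroup ZigzagModule.module

variable {𝔽 : Type u} [Field 𝔽] {o : ZigzagOrientation}

/-- Every vector space of the module is finite-dimensional. -/
def LocallyFinite (V : ZigzagModule.{u, v} 𝔽 o) : Prop :=
  ∀ i, FiniteDimensional 𝔽 (V.obj i)

/-- Some vector space of the module is non-zero. -/
def IsNonzero (V : ZigzagModule.{u, v} 𝔽 o) : Prop :=
  ∃ i, Nontrivial (V.obj i)

/-- An isomorphism of zigzag persistence modules: linear isomorphisms at all indices that commute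
with all structure maps. -/
structure Iso (V : ZigzagModule.{u, v} 𝔽 o) (W : ZigzagModule.{u, w} 𝔽 o) where
  equiv : ∀ i, V.obj i ≃ₗ[𝔽] W.obj i
  comm_fwd : ∀ (i : ℤ) (h : o i = true) (x : V.obj i),
    equiv (i + 1) (V.fwd i h x) = W.fwd i h (equiv i x)
  comm_bwd : ∀ (i : ℤ) (h : o i = false) (x : V.obj (i + 1)),
    equiv i (V.bwd i h x) = W.bwd i h (equiv (i + 1) x)

/-- The (possibly infinite) direct sum of zigzag persistence modules, formed index by index. -/
noncomputable def directSum {ι : Type w} (W : ι → ZigzagModule.{u, v} 𝔽 o) :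
    ZigzagModule.{u, max w v} 𝔽 o where
  obj i := DirectSum ι fun j => (W j).obj i
  fwd i h := DirectSum.lmap fun j => (W j).fwd i h
  bwd i h := DirectSum.lmap fun j => (W j).bwd i h

/-- The integers together with `-∞ = ⊥` and `+∞ = ⊤`. -/
abbrev ExtInt : Type := WithBot (WithTop ℤ)

/-- The integer `i` satisfies `a ≤ i ≤ b`. -/
def Between (a b : ExtInt) (i : ℤ) : Prop :=
  a ≤ ((i : WithTop ℤ) : ExtInt) ∧ ((i : WithTop ℤ) : ExtInt) ≤ b

open Classical in
/-- The vector space at a single index of an interval module: `𝔽` if `P` holds, `0` otherwise. -/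
noncomputable def intervalFiber (𝔽 : Type u) [Field 𝔽] (P : Prop) : Submodule 𝔽 𝔽 :=
  if P then ⊤ else ⊥

theorem intervalFiber_le {P Q : Prop} (h : P ∧ Q) :
    intervalFiber 𝔽 P ≤ intervalFiber 𝔽 Q := by
  simp [intervalFiber, h.1, h.2]

open Classical in
/-- The identity of `𝔽` if both spaces are `𝔽`, and zero otherwise. -/
noncomputable def intervalMap (𝔽 : Type u) [Field 𝔽] (P Q : Prop) :
    intervalFiber 𝔽 P →ₗ[𝔽] intervalFiber 𝔽 Q :=
  if h : P ∧ Q then Submodule.inclusion (intervalFiber_le h) else 0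

/-- The interval persistence module `I^{[a,b]}` of shape `o`. -/
noncomputable def interval (𝔽 : Type u) [Field 𝔽] (o : ZigzagOrientation) (a b : ExtInt) :
    ZigzagModule.{u, u} 𝔽 o where
  obj i := intervalFiber 𝔽 (Between a b i)
  fwd i _ := intervalMap 𝔽 (Between a b i) (Between a b (i + 1))
  bwd i _ := intervalMap 𝔽 (Between a b (i + 1)) (Between a b i)

end ZigzagModule

/-!
The decomposition is obtained by splitting off interval modules one at a time.

A morphism from an interval module to `V` is a family of vectors `x i`, and a morphism from `V` to it
is a family of functionals `φ i`, both compatible with the arrows (`Link.Compat`). If `φ i (x i) = 1`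
on the interval, then the interval module is a direct summand of `V` with complement `ker φ`. So the
heart of the matter is to find such families around an index `i₀` with `V i₀ ≠ 0`
(`exists_interval_retract`).

Look at the half-line to the right of `i₀`. Let `P k` and `Q k` be the subspaces of those vectors
at `i₀` which can be continued through `k` arrows so as to end in zero, respectively anywhere. They
form a chain `P 0 ≤ P 1 ≤ … ≤ Q 1 ≤ Q 0`. Its successive quotients belong to the possible right
endpoints of an interval: if `A ≤ B` are consecutive, then a vector in `B` and a functional that
kills `A` continue compatibly up to the corresponding endpoint. The limit gap, between the union of
the `P k` and the intersection of the `Q k`, belongs to the intervals without right endpoint; there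
the continuation exists because chains of subspaces of a finite-dimensional space stabilize. The
half-line to the left gives a second chain. As in the Schreier refinement theorem, some step `A ≤ B`
of the right chain and some step `A' ≤ B'` of the left chain satisfy `¬ B' ⊓ B ≤ A' ⊔ A`
(`exists_propagates`, used once on each side). A vector of `B' ⊓ B` outside `A' ⊔ A` and a functional
that detects it modulo `A' ⊔ A` continue in both directions and give the summand.

Finally, split off intervals from the successive complements, in an order such that each index is
treated infinitely often. At each index the complement then vanishes after finitely many steps, and
the generators of the intervals found so far form a basis of the space at this index
(`bijective_of_filtration`).
-/

/-! ### Links -/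

namespace ZigzagModule

open Module

variable {𝔽 : Type u} [Field 𝔽]

/-- A single arrow between the vector spaces `X` and `Y`, in one of the two directions. -/
inductive Link (𝔽 : Type u) [Field 𝔽] (X Y : Type v) [AddCommGroup X] [Module 𝔽 X]
    [AddCommGroup Y] [Module 𝔽 Y] : Type v
  | out (f : X →ₗ[𝔽] Y) : Link 𝔽 X Y
  | inn (g : Y →ₗ[𝔽] X) : Link 𝔽 X Y

namespace Link

variable {X Y : Type v} [AddCommGroup X] [Module 𝔽 X] [AddCommGroup Y] [Module 𝔽 Y]

/-- The same arrow, with the two spaces listed in the opposite order. -/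
def flip : Link 𝔽 X Y → Link 𝔽 Y X
  | out f => inn f
  | inn g => out g

/-- The subspace of those vectors of `X` that the link relates to some vector of `S`. -/
def pull : Link 𝔽 X Y → Submodule 𝔽 Y → Submodule 𝔽 X
  | out f, S => S.comap f
  | inn g, S => S.map g

theorem pull_mono (ℓ : Link 𝔽 X Y) {S T : Submodule 𝔽 Y} (h : S ≤ T) : ℓ.pull S ≤ ℓ.pull T := by
  cases ℓ with
  | out f => exact Submodule.comap_mono h
  | inn g => exact Submodule.map_mono h

/-- Vectors `x`, `y` and functionals `φ`, `ψ` at the two ends of a link are compatible. Here `p` and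
`q` say whether `X` and `Y` belong to the support of an interval module: `x`, `y` are the values at
these places of a morphism from the interval module, and `φ`, `ψ` those of a morphism to it.
A morphism from the interval module is constrained only if the source of the arrow lies in the
support, a morphism to it only if the target does. -/
def Compat : Link 𝔽 X Y → (p q : Prop) → (x : X) → (φ : Dual 𝔽 X) → (y : Y) → (ψ : Dual 𝔽 Y) → Prop
  | out f, p, q, x, φ, y, ψ => (p → f x = y) ∧ (q → ψ ∘ₗ f = φ)
  | inn g, p, q, x, φ, y, ψ => (q → g y = x) ∧ (p → φ ∘ₗ g = ψ)

theorem Compat.flip {ℓ : Link 𝔽 X Y} {p q : Prop} {x : X} {φ : Dual 𝔽 X} {y : Y} {ψ : Dual 𝔽 Y}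
    (h : ℓ.flip.Compat q p y ψ x φ) : ℓ.Compat p q x φ y ψ := by
  cases ℓ <;> exact h

/-- Compatible pairs inside the support have the same value `φ x`. -/
theorem Compat.apply_eq {ℓ : Link 𝔽 X Y} {p q : Prop} {x : X} {φ : Dual 𝔽 X} {y : Y}
    {ψ : Dual 𝔽 Y} (h : ℓ.Compat p q x φ y ψ) (hp : p) (hq : q) : ψ y = φ x := by
  cases ℓ with
  | out f => rw [← h.1 hp, ← h.2 hq]; rfl
  | inn g => rw [← h.1 hq, ← h.2 hp]; rfl

/-- A functional that kills the preimage of `S` under `f` factors through `f` by a functional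
that kills `S`. -/
theorem exists_dual_comp_eq (f : X →ₗ[𝔽] Y) {S : Submodule 𝔽 Y} {φ : Dual 𝔽 X}
    (h : S.comap f ≤ LinearMap.ker φ) : ∃ ψ : Dual 𝔽 Y, S ≤ LinearMap.ker ψ ∧ ψ ∘ₗ f = φ := by
  have hk : LinearMap.ker (S.mkQ ∘ₗ f) ≤ LinearMap.ker φ := by
    rwa [LinearMap.ker_comp, Submodule.ker_mkQ]
  obtain ⟨θ, hθ⟩ := LinearMap.exists_extend
    ((LinearMap.ker (S.mkQ ∘ₗ f)).liftQ φ hk ∘ₗ (S.mkQ ∘ₗ f).quotKerEquivRange.symm.toLinearMap)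
  refine ⟨θ ∘ₗ S.mkQ, fun y hy => ?_, ?_⟩
  · simp [(Submodule.Quotient.mk_eq_zero S).2 hy]
  · ext x
    have := LinearMap.congr_fun hθ ((S.mkQ ∘ₗ f).quotKerEquivRange (Submodule.Quotient.mk x))
    simpa using this

/-- The propagation step: vectors in `B` and functionals killing `A` can be continued across the
link, when the subspaces at the two ends fit together. The hypothesis `hpq` is the condition on a
link inside the support. Where the support ends, by `hp` either the arrow leaves the support and
kills `B`, or it enters the support and has its range in `A`. -/
theorem exists_compat (ℓ : Link 𝔽 X Y) {p q : Prop} {A B : Submodule 𝔽 X} {A' B' : Submodule 𝔽 Y}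
    (hpq : p → q → B ≤ ℓ.pull B' ∧ ℓ.pull A' ≤ A)
    (hp : p → ¬ q → B ≤ ℓ.pull ⊥ ∧ (∃ f, ℓ = out f) ∨ ℓ.pull ⊤ ≤ A ∧ (∃ g, ℓ = inn g))
    (hqp : q → p)
    {x : X} {φ : Dual 𝔽 X} (hx : p → x ∈ B) (hφ : p → A ≤ LinearMap.ker φ) :
    ∃ (y : Y) (ψ : Dual 𝔽 Y), (q → y ∈ B') ∧ (q → A' ≤ LinearMap.ker ψ) ∧ (¬ q → y = 0 ∧ ψ = 0) ∧
      ℓ.Compat p q x φ y ψ := by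
  by_cases q' : q
  · have p' := hqp q'
    obtain ⟨h1, h2⟩ := hpq p' q'
    cases ℓ with
    | out f =>
      obtain ⟨ψ, hψ, e⟩ := exists_dual_comp_eq f (h2.trans (hφ p'))
      exact ⟨f x, ψ, fun _ => h1 (hx p'), fun _ => hψ, fun h => (h q').elim,
        fun _ => rfl, fun _ => e⟩
    | inn g =>
      obtain ⟨y, hy, e⟩ := h1 (hx p')
      exact ⟨y, φ ∘ₗ g, fun _ => hy,
        fun _ a ha => hφ p' (h2 (Submodule.mem_map_of_mem ha)), fun h => (h q').elim,
        fun _ => e, fun _ => rfl⟩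
  · refine ⟨0, 0, fun h => (q' h).elim, fun h => (q' h).elim, fun _ => ⟨rfl, rfl⟩, ?_⟩
    by_cases p' : p
    · rcases hp p' q' with ⟨h, f, rfl⟩ | ⟨h, g, rfl⟩
      · exact ⟨fun _ => h (hx p'), fun h => (q' h).elim⟩
      · refine ⟨fun h => (q' h).elim, fun _ => LinearMap.ext fun y => ?_⟩
        exact hφ p' (h (Submodule.mem_map_of_mem Submodule.mem_top))
    · cases ℓ with
      | out f => exact ⟨fun h => (p' h).elim, fun h => (q' h).elim⟩
      | inn g => exact ⟨fun h => (q' h).elim, fun h => (p' h).elim⟩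

end Link

theorem exists_dual_eq_one {E : Type*} [AddCommGroup E] [Module 𝔽 E] {S : Submodule 𝔽 E} {x : E}
    (hx : x ∉ S) : ∃ φ : Dual 𝔽 E, φ x = 1 ∧ S ≤ LinearMap.ker φ := by
  obtain ⟨f, hf, hle⟩ := Submodule.exists_le_ker_of_notMem hx
  refine ⟨(f x)⁻¹ • f, by simp [inv_mul_cancel₀ hf], fun y hy => ?_⟩
  have : f y = 0 := hle hy
  simp [this]

/-- Dependent choice for a sequence of types. -/
theorem exists_seq_of_step {S : ℕ → Type*} (p : ∀ n, S n → Prop) (r : ∀ n, S n → S (n + 1) → Prop)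
    (x₀ : S 0) (h₀ : p 0 x₀) (step : ∀ n x, p n x → ∃ y, p (n + 1) y ∧ r n x y) :
    ∃ ξ : ∀ n, S n, ξ 0 = x₀ ∧ ∀ n, p n (ξ n) ∧ r n (ξ n) (ξ (n + 1)) := by
  choose g hg using step
  let ξ : ∀ n, {x : S n // p n x} := fun n =>
    Nat.rec ⟨x₀, h₀⟩ (fun n s => ⟨g n s.1 s.2, (hg n s.1 s.2).1⟩) n
  exact ⟨fun n => (ξ n).1, rfl, fun n => ⟨(ξ n).2, (hg n _ (ξ n).2).2⟩⟩

/-! ### Half-lines -/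

section HalfLine

variable {W : ℕ → Type v} [∀ n, AddCommGroup (W n)] [∀ n, Module 𝔽 (W n)]
  (ℓ : ∀ n, Link 𝔽 (W n) (W (n + 1)))

/-- The vectors at place `n` of a half-line that can be continued for `k` steps so as to end in the
given subspace at place `n + k`. -/
def pullIter (S : ∀ n, Submodule 𝔽 (W n)) : ℕ → ∀ n, Submodule 𝔽 (W n)
  | 0, n => S n
  | k + 1, n => (ℓ n).pull (pullIter S k (n + 1))

theorem pullIter_mono {S T : ∀ n, Submodule 𝔽 (W n)} (h : ∀ n, S n ≤ T n) (k n : ℕ) :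
    pullIter ℓ S k n ≤ pullIter ℓ T k n := by
  induction k generalizing n with
  | zero => exact h n
  | succ k ih => exact (ℓ n).pull_mono (ih (n + 1))

theorem pullIter_congr {S T : ∀ n, Submodule 𝔽 (W n)} (k n : ℕ) (h : S (n + k) = T (n + k)) :
    pullIter ℓ S k n = pullIter ℓ T k n := by
  induction k generalizing n with
  | zero => exact h
  | succ k ih =>
    have e : n + 1 + k = n + (k + 1) := by omega
    exact congrArg (ℓ n).pull (ih (n + 1) (by rw [e]; exact h))

theorem pullIter_succ' (S : ∀ n, Submodule 𝔽 (W n)) (k n : ℕ) :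
    pullIter ℓ S (k + 1) n = pullIter ℓ (fun m => (ℓ m).pull (S (m + 1))) k n := by
  induction k generalizing n with
  | zero => rfl
  | succ k ih => exact congrArg (ℓ n).pull (ih (n + 1))

theorem monotone_pullIter_bot (n : ℕ) : Monotone fun k => pullIter ℓ (fun _ => ⊥) k n :=
  monotone_nat_of_le_succ fun k => by
    rw [pullIter_succ']
    exact pullIter_mono ℓ (fun _ => bot_le) k n

theorem antitone_pullIter_top (n : ℕ) : Antitone fun k => pullIter ℓ (fun _ => ⊤) k n :=
  antitone_nat_of_succ_le fun k => by
    rw [pullIter_succ']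
    exact pullIter_mono ℓ (fun _ => le_top) k n

theorem pullIter_bot_le_top (j k n : ℕ) :
    pullIter ℓ (fun _ => ⊥) j n ≤ pullIter ℓ (fun _ => ⊤) k n :=
  calc
    _ ≤ pullIter ℓ (fun _ => ⊥) (max j k) n := monotone_pullIter_bot ℓ n (le_max_left j k)
    _ ≤ pullIter ℓ (fun _ => ⊤) (max j k) n := pullIter_mono ℓ (fun _ => bot_le) _ n
    _ ≤ _ := antitone_pullIter_top ℓ n (le_max_right j k)

/-- The pair of subspaces `A ≤ B` at the start of a half-line belongs to the intervals of length
`b`: each vector of `B` and each functional killing `A` continue to compatible families supported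
on the first `b + 1` places. -/
def Propagates (b : ℕ∞) (A B : Submodule 𝔽 (W 0)) : Prop :=
  ∀ x ∈ B, ∀ φ : Dual 𝔽 (W 0), A ≤ LinearMap.ker φ →
    ∃ ξ : ∀ n, W n × Dual 𝔽 (W n), ξ 0 = (x, φ) ∧
      (∀ n : ℕ, ¬ (n : ℕ∞) ≤ b → ξ n = 0) ∧
      ∀ n : ℕ, (ℓ n).Compat ((n : ℕ∞) ≤ b) (((n + 1 : ℕ) : ℕ∞) ≤ b)
        (ξ n).1 (ξ n).2 (ξ (n + 1)).1 (ξ (n + 1)).2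

/-- The pair at the start propagates if it extends to pairs at all places of the support that fit
together along the links, with the boundary condition of an interval module at the last place. -/
theorem propagates_of_families (b : ℕ∞) (A B : ∀ n, Submodule 𝔽 (W n))
    (hlt : ∀ n : ℕ, ((n + 1 : ℕ) : ℕ∞) ≤ b →
      B n ≤ (ℓ n).pull (B (n + 1)) ∧ (ℓ n).pull (A (n + 1)) ≤ A n)
    (hend : ∀ n : ℕ, (n : ℕ∞) = b → B n ≤ (ℓ n).pull ⊥ ∧ (∃ f, ℓ n = .out f) ∨
      (ℓ n).pull ⊤ ≤ A n ∧ (∃ g, ℓ n = .inn g)) :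
    Propagates ℓ b (A 0) (B 0) := by
  intro x hx φ hφ
  obtain ⟨ξ, h0, h⟩ := exists_seq_of_step (S := fun n => W n × Dual 𝔽 (W n))
    (fun n s => ((n : ℕ∞) ≤ b → s.1 ∈ B n) ∧ ((n : ℕ∞) ≤ b → A n ≤ LinearMap.ker s.2) ∧
      (¬ (n : ℕ∞) ≤ b → s.1 = 0 ∧ s.2 = 0))
    (fun n s t => (ℓ n).Compat ((n : ℕ∞) ≤ b) (((n + 1 : ℕ) : ℕ∞) ≤ b) s.1 s.2 t.1 t.2)
    (x, φ) ⟨fun _ => hx, fun _ => hφ, fun h => (h (by simp)).elim⟩ (by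
      rintro n ⟨y, ψ⟩ ⟨h1, h2, -⟩
      obtain ⟨z, θ, hz⟩ := (ℓ n).exists_compat (p := (n : ℕ∞) ≤ b)
        (q := ((n + 1 : ℕ) : ℕ∞) ≤ b) (fun _ => hlt n)
        (fun hp hq => hend n (by
          refine le_antisymm hp (le_of_not_gt fun hlt => hq ?_)
          push_cast
          exact Order.add_one_le_of_lt hlt))
        (fun hq => le_trans (by exact_mod_cast n.le_succ) hq) h1 h2
      exact ⟨(z, θ), ⟨hz.1, hz.2.1, hz.2.2.1⟩, hz.2.2.2⟩)
  exact ⟨ξ, h0, fun n hn => Prod.ext ((h n).1.2.2 hn).1 ((h n).1.2.2 hn).2, fun n => (h n).2⟩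

/-- If the arrow after place `k` points away from the start, the intervals that end at place `k` are
those of the vectors that reach its kernel, modulo those that reach zero. -/
theorem propagates_bot (k : ℕ) (h : ∃ f, ℓ k = .out f) :
    Propagates ℓ k (pullIter ℓ (fun _ => ⊥) k 0) (pullIter ℓ (fun _ => ⊥) (k + 1) 0) := by
  refine propagates_of_families ℓ k (fun n => pullIter ℓ (fun _ => ⊥) (k - n) n)
    (fun n => pullIter ℓ (fun _ => ⊥) (k + 1 - n) n) (fun n hn => ?_) (fun n hn => ?_)
  · have hn' : n + 1 ≤ k := by exact_mod_cast hn
    have e1 : k + 1 - n = (k + 1 - (n + 1)) + 1 := by omega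
    have e2 : k - n = (k - (n + 1)) + 1 := by omega
    constructor
    · rw [e1]; exact le_rfl
    · rw [e2]; exact le_rfl
  · obtain rfl : n = k := by exact_mod_cast hn
    refine Or.inl ⟨?_, h⟩
    rw [Nat.add_sub_cancel_left]
    exact le_rfl

/-- If the arrow after place `k` points towards the start, the intervals that end at place `k` are
those of the vectors that can be continued to place `k`, modulo those that can be continued into its
range. -/
theorem propagates_top (k : ℕ) (h : ∃ g, ℓ k = .inn g) :
    Propagates ℓ k (pullIter ℓ (fun _ => ⊤) (k + 1) 0) (pullIter ℓ (fun _ => ⊤) k 0) := by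
  refine propagates_of_families ℓ k (fun n => pullIter ℓ (fun _ => ⊤) (k + 1 - n) n)
    (fun n => pullIter ℓ (fun _ => ⊤) (k - n) n) (fun n hn => ?_) (fun n hn => ?_)
  · have hn' : n + 1 ≤ k := by exact_mod_cast hn
    have e1 : k + 1 - n = (k + 1 - (n + 1)) + 1 := by omega
    have e2 : k - n = (k - (n + 1)) + 1 := by omega
    constructor
    · rw [e2]; exact le_rfl
    · rw [e1]; exact le_rfl
  · obtain rfl : n = k := by exact_mod_cast hn
    refine Or.inr ⟨?_, h⟩
    rw [Nat.add_sub_cancel_left]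
    exact le_rfl

theorem exists_iInf_eq_of_antitone {E : Type*} [AddCommGroup E] [Module 𝔽 E]
    [FiniteDimensional 𝔽 E] {S : ℕ → Submodule 𝔽 E} (h : Antitone S) : ∃ k, ⨅ n, S n = S k := by
  obtain ⟨k, hk⟩ := IsArtinian.monotone_stabilizes ⟨fun n => OrderDual.toDual (S n), h⟩
  refine ⟨k, le_antisymm (iInf_le _ _) (le_iInf fun n => ?_)⟩
  rcases le_total k n with hn | hn
  · exact le_of_eq (hk n hn)
  · exact h hn

theorem exists_iSup_eq_of_monotone {E : Type*} [AddCommGroup E] [Module 𝔽 E]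
    [FiniteDimensional 𝔽 E] {S : ℕ → Submodule 𝔽 E} (h : Monotone S) : ∃ k, ⨆ n, S n = S k := by
  obtain ⟨k, hk⟩ := monotone_stabilizes_iff_noetherian.2 inferInstance ⟨S, h⟩
  refine ⟨k, le_antisymm (iSup_le fun n => ?_) (le_iSup _ _)⟩
  rcases le_total k n with hn | hn
  · exact le_of_eq (hk n hn).symm
  · exact h hn

variable [∀ n, FiniteDimensional 𝔽 (W n)]

/-- For intervals of infinite length. Finite-dimensionality enters here in the manner of
Mittag-Leffler: a vector that can be continued for any finite number of steps has a next vector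
with the same property. -/
theorem propagates_infinite :
    Propagates ℓ ⊤ (⨆ k, pullIter ℓ (fun _ => ⊥) k 0) (⨅ k, pullIter ℓ (fun _ => ⊤) k 0) := by
  refine propagates_of_families ℓ ⊤ (fun n => ⨆ k, pullIter ℓ (fun _ => ⊥) k n)
    (fun n => ⨅ k, pullIter ℓ (fun _ => ⊤) k n) (fun n _ => ⟨?_, ?_⟩)
    (fun n hn => (ENat.natCast_ne_top n hn).elim)
  · obtain ⟨k, hk⟩ := exists_iInf_eq_of_antitone (antitone_pullIter_top ℓ (n + 1))
    rw [hk]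
    exact iInf_le _ (k + 1)
  · obtain ⟨k, hk⟩ := exists_iSup_eq_of_monotone (monotone_pullIter_bot ℓ (n + 1))
    rw [hk]
    exact le_iSup (fun k => pullIter ℓ (fun _ => ⊥) k n) (k + 1)

/-- Say that `D / C` meets `B / A` if `B ⊓ D` is not contained in `A ⊔ C`. If `D / C` meets `B / A`,
then it meets `M / A` or `B / M`. -/
theorem linked_split {E : Type*} [AddCommGroup E] [Module 𝔽 E] {A B C D : Submodule 𝔽 E}
    (M : Submodule 𝔽 E) (hCD : C ≤ D) (h : ¬ B ⊓ D ≤ A ⊔ C) :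
    ¬ M ⊓ D ≤ A ⊔ C ∨ ¬ B ⊓ D ≤ M ⊔ C := by
  by_contra! ⟨h1, h2⟩
  refine h fun x hx => ?_
  obtain ⟨m, hm, c, hc, rfl⟩ := Submodule.mem_sup.1 (h2 hx)
  have hmD : m ∈ D := by simpa using D.sub_mem hx.2 (hCD hc)
  exact add_mem (h1 ⟨hm, hmD⟩) (Submodule.mem_sup_right hc)

/-- A nonzero subquotient `D / C` at the start of a half-line meets, in the sense of
`linked_split`, one of the subquotients `B / A` that belong to the intervals starting there. -/
theorem exists_propagates {C D : Submodule 𝔽 (W 0)} (hCD : C ≤ D) (h : ¬ D ≤ C) :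
    ∃ (b : ℕ∞) (A B : Submodule 𝔽 (W 0)), A ≤ B ∧ ¬ B ⊓ D ≤ A ⊔ C ∧ Propagates ℓ b A B := by
  set P : ℕ → Submodule 𝔽 (W 0) := fun k => pullIter ℓ (fun _ => ⊥) k 0 with hP
  set Q : ℕ → Submodule 𝔽 (W 0) := fun k => pullIter ℓ (fun _ => ⊤) k 0 with hQ
  by_cases hall : ∀ k, ¬ Q k ⊓ D ≤ P k ⊔ C
  · refine ⟨⊤, ⨆ k, P k, ⨅ k, Q k, ?_, ?_, propagates_infinite ℓ⟩
    · exact iSup_le fun j => le_iInf fun k => pullIter_bot_le_top ℓ j k 0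
    · obtain ⟨j, hj⟩ := exists_iSup_eq_of_monotone (monotone_pullIter_bot ℓ 0)
      obtain ⟨k, hk⟩ := exists_iInf_eq_of_antitone (antitone_pullIter_top ℓ 0)
      intro hle
      refine hall (max j k) (le_trans ?_ (hle.trans ?_))
      · refine inf_le_inf_right _ (le_trans ?_ hk.ge)
        exact antitone_pullIter_top ℓ 0 (le_max_right j k)
      · refine sup_le_sup_right (le_trans hj.le ?_) _
        exact monotone_pullIter_bot ℓ 0 (le_max_left j k)
  · -- In the chain `P 0 ≤ P 1 ≤ … ≤ Q 1 ≤ Q 0`, find `k` such that `D / C` meets `Q k / P k` but not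
    -- `Q (k + 1) / P (k + 1)`. Then it meets one of the two gaps, and a gap that is met is not trivial,
    -- which determines the direction of the arrow at `k`.
    have h0 : ¬ Q 0 ⊓ D ≤ P 0 ⊔ C := by simpa [hP, hQ, pullIter] using h
    obtain ⟨k, hk, hk'⟩ : ∃ k, ¬ Q k ⊓ D ≤ P k ⊔ C ∧ Q (k + 1) ⊓ D ≤ P (k + 1) ⊔ C := by
      by_contra! hcon
      exact hall fun k => Nat.rec h0 (fun k ih => hcon k ih) k
    have hcase : ¬ P (k + 1) ⊓ D ≤ P k ⊔ C ∨ ¬ Q k ⊓ D ≤ Q (k + 1) ⊔ C := by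
      rcases linked_split (P (k + 1)) hCD hk with h1 | h1
      · exact Or.inl h1
      · rcases linked_split (Q (k + 1)) hCD h1 with h2 | h2
        · exact (h2 hk').elim
        · exact Or.inr h2
    rcases hcase with h1 | h1
    · refine ⟨k, P k, P (k + 1), monotone_pullIter_bot ℓ 0 k.le_succ, h1, propagates_bot ℓ k ?_⟩
      cases hl : ℓ k with
      | out f => exact ⟨f, rfl⟩
      | inn g =>
        refine (h1 (inf_le_left.trans (le_sup_of_le_left (le_of_eq ?_)))).elim
        refine (pullIter_succ' ℓ _ k 0).trans (pullIter_congr ℓ k 0 ?_)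
        rw [Nat.zero_add, hl]
        exact Submodule.map_bot g
    · refine ⟨k, Q (k + 1), Q k, antitone_pullIter_top ℓ 0 k.le_succ, h1, propagates_top ℓ k ?_⟩
      cases hl : ℓ k with
      | inn g => exact ⟨g, rfl⟩
      | out f =>
        refine (h1 (inf_le_left.trans (le_sup_of_le_left (le_of_eq ?_)))).elim
        refine ((pullIter_succ' ℓ _ k 0).trans (pullIter_congr ℓ k 0 ?_)).symm
        rw [Nat.zero_add, hl]
        exact Submodule.comap_top f

theorem exists_propagates_of_nontrivial [Nontrivial (W 0)] :
    ∃ (b : ℕ∞) (A B : Submodule 𝔽 (W 0)), A ≤ B ∧ ¬ B ≤ A ∧ Propagates ℓ b A B := by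
  obtain ⟨b, A, B, hAB, h, hb⟩ := exists_propagates ℓ (C := ⊥) (D := ⊤) bot_le
    (fun hle => bot_ne_top (le_antisymm bot_le hle))
  rw [inf_top_eq, sup_bot_eq] at h
  exact ⟨b, A, B, hAB, h, hb⟩

end HalfLine

/-! ### Interval summands -/

variable {o : ZigzagOrientation}

/-- The arrow of a zigzag module between two consecutive indices, as a link. The second index is
a variable of its own, so that the arrow can be used at indices that are only provably
consecutive. -/
def link (V : ZigzagModule.{u, v} 𝔽 o) (i j : ℤ) (h : j = i + 1) :
    Link 𝔽 (V.obj i) (V.obj j) := by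
  subst h
  exact if ho : o i = true then .out (V.fwd i ho) else .inn (V.bwd i (by simpa using ho))

theorem link_of_true (V : ZigzagModule.{u, v} 𝔽 o) {i : ℤ} (h : o i = true) :
    V.link i (i + 1) rfl = .out (V.fwd i h) := dif_pos h

theorem link_of_false (V : ZigzagModule.{u, v} 𝔽 o) {i : ℤ} (h : o i = false) :
    V.link i (i + 1) rfl = .inn (V.bwd i h) := dif_neg (by simp [h])

/-- The indices `i₀, i₀ + 1, …`, by recursion so that the equation at successors is
definitional. -/
def rightIndex (i₀ : ℤ) : ℕ → ℤ
  | 0 => i₀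
  | n + 1 => rightIndex i₀ n + 1

/-- The indices `i₀, i₀ - 1, …`, by recursion so that the equation at successors is
definitional. -/
def leftIndex (i₀ : ℤ) : ℕ → ℤ
  | 0 => i₀
  | n + 1 => leftIndex i₀ n - 1

theorem rightIndex_eq (i₀ : ℤ) (n : ℕ) : rightIndex i₀ n = i₀ + n := by
  induction n with
  | zero => simp [rightIndex]
  | succ n ih => simp [rightIndex, ih, add_assoc]

theorem leftIndex_eq (i₀ : ℤ) (n : ℕ) : leftIndex i₀ n = i₀ - n := by
  induction n with
  | zero => simp [leftIndex]
  | succ n ih => simp [leftIndex, ih]; ring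

/-- Families on the two half-lines that start at `i₀` glue if they agree at `i₀`. -/
theorem exists_glue {S : ℤ → Type*} (i₀ : ℤ) (ξ : ∀ n, S (rightIndex i₀ n))
    (η : ∀ n, S (leftIndex i₀ n)) (h : ξ 0 = η 0) :
    ∃ s : ∀ i, S i, (∀ n, s (rightIndex i₀ n) = ξ n) ∧ ∀ n, s (leftIndex i₀ n) = η n := by
  have key : ∀ i, ∃ y : S i, (∀ n (e : rightIndex i₀ n = i), e ▸ ξ n = y) ∧
      ∀ n (e : leftIndex i₀ n = i), e ▸ η n = y := by
    intro i
    rcases le_total i₀ i with hi | hi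
    · obtain ⟨n, rfl⟩ : ∃ n, rightIndex i₀ n = i :=
        ⟨(i - i₀).toNat, by rw [rightIndex_eq]; omega⟩
      refine ⟨ξ n, fun m e => ?_, fun m e => ?_⟩
      · obtain rfl : m = n := by simp only [rightIndex_eq] at e; omega
        rfl
      · obtain ⟨rfl, rfl⟩ : m = 0 ∧ n = 0 := by
          simp only [rightIndex_eq, leftIndex_eq] at e; omega
        exact h.symm
    · obtain ⟨n, rfl⟩ : ∃ n, leftIndex i₀ n = i :=
        ⟨(i₀ - i).toNat, by rw [leftIndex_eq]; omega⟩
      refine ⟨η n, fun m e => ?_, fun m e => ?_⟩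
      · obtain ⟨rfl, rfl⟩ : m = 0 ∧ n = 0 := by
          simp only [rightIndex_eq, leftIndex_eq] at e; omega
        exact h
      · obtain rfl : m = n := by simp only [leftIndex_eq] at e; omega
        rfl
  choose s hs using key
  exact ⟨s, fun n => ((hs _).1 n rfl).symm, fun n => ((hs _).2 n rfl).symm⟩

theorem exists_lower_endpoint (i₀ : ℤ) (c : ℕ∞) :
    ∃ a : ExtInt, ∀ i : ℤ, a ≤ ((i : WithTop ℤ) : ExtInt) ↔ ((i₀ - i).toNat : ℕ∞) ≤ c := by
  induction c using ENat.recTopCoe with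
  | top => exact ⟨⊥, fun i => by simp⟩
  | coe n =>
    refine ⟨(((i₀ - n : ℤ) : WithTop ℤ) : ExtInt), fun i => ?_⟩
    rw [WithBot.coe_le_coe, WithTop.coe_le_coe, Nat.cast_le]
    omega

theorem exists_upper_endpoint (i₀ : ℤ) (c : ℕ∞) :
    ∃ b : ExtInt, ∀ i : ℤ, ((i : WithTop ℤ) : ExtInt) ≤ b ↔ ((i - i₀).toNat : ℕ∞) ≤ c := by
  induction c using ENat.recTopCoe with
  | top => exact ⟨⊤, fun i => by simp⟩
  | coe n =>
    refine ⟨(((i₀ + n : ℤ) : WithTop ℤ) : ExtInt), fun i => ?_⟩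
    rw [WithBot.coe_le_coe, WithTop.coe_le_coe, Nat.cast_le]
    omega

theorem Between.endpoints {a b : ExtInt} {i : ℤ} (h : Between a b i) :
    a ≤ b ∧ a ≠ ⊤ ∧ b ≠ ⊥ := by
  refine ⟨h.1.trans h.2, ?_, ?_⟩
  · rintro rfl
    exact WithTop.coe_ne_top (WithBot.coe_injective (top_le_iff.1 h.1))
  · rintro rfl
    exact WithBot.coe_ne_bot (le_bot_iff.1 h.2)

/-- A locally finite-dimensional zigzag module that is nonzero at `i₀` has an interval module
containing `i₀` as a direct summand: `x` is the inclusion of the summand, and `φ` is a retraction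
onto it. -/
theorem exists_interval_retract (V : ZigzagModule.{u, v} 𝔽 o) (hfin : V.LocallyFinite) (i₀ : ℤ)
    (h : Nontrivial (V.obj i₀)) :
    ∃ (a b : ExtInt) (x : ∀ i, V.obj i) (φ : ∀ i, Dual 𝔽 (V.obj i)), Between a b i₀ ∧
      (∀ i, ¬ Between a b i → x i = 0 ∧ φ i = 0) ∧ (∀ i, Between a b i → φ i (x i) = 1) ∧
      ∀ i, (V.link i (i + 1) rfl).Compat (Between a b i) (Between a b (i + 1))
        (x i) (φ i) (x (i + 1)) (φ (i + 1)) := by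
  have : ∀ i, FiniteDimensional 𝔽 (V.obj i) := hfin
  let R : ∀ n, Link 𝔽 (V.obj (rightIndex i₀ n)) (V.obj (rightIndex i₀ (n + 1))) :=
    fun n => V.link _ _ rfl
  let L : ∀ n, Link 𝔽 (V.obj (leftIndex i₀ n)) (V.obj (leftIndex i₀ (n + 1))) :=
    fun n => (V.link (leftIndex i₀ (n + 1)) (leftIndex i₀ n) (sub_add_cancel _ _).symm).flip
  have : Nontrivial (V.obj (rightIndex i₀ 0)) := h
  obtain ⟨b', A, B, hAB, h1, hR⟩ := exists_propagates_of_nontrivial R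
  obtain ⟨a', A', B', -, h2, hL⟩ := exists_propagates L (C := A) (D := B) hAB h1
  obtain ⟨x₀, ⟨hxL, hxR⟩, hx⟩ := Set.not_subset.1 h2
  -- A functional that detects `x₀` modulo the subspaces on both sides.
  obtain ⟨φ₀, hφ₀, hle⟩ := exists_dual_eq_one hx
  obtain ⟨ξ, ξ0, ξz, ξc⟩ := hR x₀ hxR φ₀ (le_sup_right.trans hle)
  obtain ⟨η, η0, ηz, ηc⟩ := hL x₀ hxL φ₀ (le_sup_left.trans hle)
  obtain ⟨s, hsR, hsL⟩ := exists_glue (S := fun i => V.obj i × Dual 𝔽 (V.obj i)) i₀ ξ η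
    (ξ0.trans η0.symm)
  obtain ⟨a, ha⟩ := exists_lower_endpoint i₀ a'
  obtain ⟨b, hb⟩ := exists_upper_endpoint i₀ b'
  have hbR : ∀ n, Between a b (rightIndex i₀ n) ↔ (n : ℕ∞) ≤ b' := fun n => by
    have e1 : (i₀ - (i₀ + n)).toNat = 0 := by omega
    have e2 : (i₀ + n - i₀).toNat = n := by omega
    rw [Between, ha, hb, rightIndex_eq, e1, e2]
    simp
  have hbL : ∀ n, Between a b (leftIndex i₀ n) ↔ (n : ℕ∞) ≤ a' := fun n => by
    have e1 : (i₀ - (i₀ - n)).toNat = n := by omega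
    have e2 : (i₀ - n - i₀).toNat = 0 := by omega
    rw [Between, ha, hb, leftIndex_eq, e1, e2]
    simp
  have hcases : ∀ i, (∃ n, rightIndex i₀ n = i) ∨ ∃ n, leftIndex i₀ (n + 1) = i := fun i => by
    rcases le_or_gt i₀ i with hi | hi
    · exact Or.inl ⟨(i - i₀).toNat, by rw [rightIndex_eq]; omega⟩
    · exact Or.inr ⟨(i₀ - i - 1).toNat, by rw [leftIndex_eq]; omega⟩
  refine ⟨a, b, fun i => (s i).1, fun i => (s i).2, (hbR 0).2 (by simp), fun i hi => ?_,
    fun i hi => ?_, fun i => ?_⟩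
  · suffices s i = 0 from ⟨congrArg Prod.fst this, congrArg Prod.snd this⟩
    rcases hcases i with ⟨n, rfl⟩ | ⟨n, rfl⟩
    · rw [hsR]; exact ξz n fun hn => hi ((hbR n).2 hn)
    · rw [hsL]; exact ηz _ fun hn => hi ((hbL _).2 hn)
  · change (s i).2 (s i).1 = 1
    rcases hcases i with ⟨n, rfl⟩ | ⟨n, rfl⟩
    · rw [hbR] at hi
      rw [hsR]
      clear * - ξ0 ξc hφ₀ hi
      induction n with
      | zero => rw [ξ0]; exact hφ₀
      | succ n ih =>
        have hn : (n : ℕ∞) ≤ b' := le_trans (by exact_mod_cast n.le_succ) hi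
        exact ((ξc n).apply_eq hn hi).trans (ih hn)
    · rw [hbL] at hi
      rw [hsL]
      generalize n + 1 = n at hi
      clear * - η0 ηc hφ₀ hi
      induction n with
      | zero => rw [η0]; exact hφ₀
      | succ n ih =>
        have hn : (n : ℕ∞) ≤ a' := le_trans (by exact_mod_cast n.le_succ) hi
        exact ((ηc n).apply_eq hn hi).trans (ih hn)
  · suffices ∀ j (e : j = i + 1), (V.link i j e).Compat (Between a b i) (Between a b j)
        (s i).1 (s i).2 (s j).1 (s j).2 from this _ rfl
    intro j e
    rcases hcases i with ⟨n, rfl⟩ | ⟨n, rfl⟩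
    · obtain rfl : rightIndex i₀ (n + 1) = j := e.symm
      rw [hbR, hbR, hsR, hsR]
      exact ξc n
    · obtain rfl : leftIndex i₀ n = j := by rw [e, leftIndex, sub_add_cancel]
      rw [hbL, hbL, hsL, hsL]
      exact (ηc n).flip

/-! ### Splitting off an interval from a submodule -/

/-- A submodule of a zigzag module: a subspace at each index, preserved by the structure maps. -/
structure Subrep (V : ZigzagModule.{u, v} 𝔽 o) where
  carrier : ∀ i, Submodule 𝔽 (V.obj i)
  fwd_mem : ∀ i (h : o i = true), ∀ y ∈ carrier i, V.fwd i h y ∈ carrier (i + 1)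
  bwd_mem : ∀ i (h : o i = false), ∀ y ∈ carrier (i + 1), V.bwd i h y ∈ carrier i

namespace Subrep

variable {V : ZigzagModule.{u, v} 𝔽 o}

/-- A submodule, as a zigzag module in its own right. -/
def toModule (U : V.Subrep) : ZigzagModule.{u, v} 𝔽 o where
  obj i := U.carrier i
  fwd i h := (V.fwd i h).restrict (U.fwd_mem i h)
  bwd i h := (V.bwd i h).restrict (U.bwd_mem i h)

/-- `U` is the direct sum of `U'` and of the interval module on `[a, b]` whose generators are the
vectors `x i`, where `x i = 0` for `i` outside the interval. -/
structure Splits (U U' : V.Subrep) (a b : ExtInt) (x : ∀ i, V.obj i) : Prop where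
  le : ∀ i, U'.carrier i ≤ U.carrier i
  mem : ∀ i, x i ∈ U.carrier i
  notMem : ∀ i, Between a b i → x i ∉ U'.carrier i
  eq_zero : ∀ i, ¬ Between a b i → x i = 0
  le_sup : ∀ i, U.carrier i ≤ Submodule.span 𝔽 {x i} ⊔ U'.carrier i
  fwd_eq : ∀ i (h : o i = true), Between a b i → V.fwd i h (x i) = x (i + 1)
  bwd_eq : ∀ i (h : o i = false), Between a b (i + 1) → V.bwd i h (x (i + 1)) = x i

/-- The complement is the kernel of the retraction given by `exists_interval_retract`. -/
theorem exists_splits (hfin : V.LocallyFinite) (U : V.Subrep) (i₀ : ℤ) (h : U.carrier i₀ ≠ ⊥) :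
    ∃ (U' : V.Subrep) (a b : ExtInt) (x : ∀ i, V.obj i),
      Between a b i₀ ∧ Splits U U' a b x := by
  have : ∀ i, FiniteDimensional 𝔽 (V.obj i) := hfin
  obtain ⟨a, b, x, φ, h0, hz, h1, hc⟩ := exists_interval_retract U.toModule
    (fun i => inferInstanceAs (FiniteDimensional 𝔽 (U.carrier i))) i₀
    (Submodule.nontrivial_iff_ne_bot.2 h)
  let U' : V.Subrep :=
    { carrier := fun i => (LinearMap.ker (φ i)).map (U.carrier i).subtype
      fwd_mem := by
        rintro i hi _ ⟨y, hy, rfl⟩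
        refine ⟨U.toModule.fwd i hi y, ?_, rfl⟩
        have hc := hc i
        rw [link_of_true _ hi] at hc
        by_cases hb : Between a b (i + 1)
        · exact (LinearMap.congr_fun (hc.2 hb) y).trans hy
        · exact LinearMap.congr_fun (hz _ hb).2 _
      bwd_mem := by
        rintro i hi _ ⟨y, hy, rfl⟩
        refine ⟨U.toModule.bwd i hi y, ?_, rfl⟩
        have hc := hc i
        rw [link_of_false _ hi] at hc
        by_cases hb : Between a b i
        · exact (LinearMap.congr_fun (hc.2 hb) y).trans hy
        · exact LinearMap.congr_fun (hz _ hb).2 _ }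
  refine ⟨U', a, b, fun i => (x i : U.carrier i).1, h0, ?_, ?_, ?_, ?_, ?_, ?_, ?_⟩
  · rintro i _ ⟨y, -, rfl⟩
    exact y.2
  · exact fun i => (x i : U.carrier i).2
  · rintro i hi ⟨y, hy, e⟩
    obtain rfl : y = x i := Subtype.ext e
    exact one_ne_zero ((h1 i hi).symm.trans hy)
  · intro i hi
    rw [(hz i hi).1]
    rfl
  · intro i y hy
    let z : U.toModule.obj i := (⟨y, hy⟩ : U.carrier i)
    have hker : φ i (z - φ i z • x i) = 0 := by
      by_cases hb : Between a b i
      · rw [map_sub, map_smul, h1 i hb, smul_eq_mul, mul_one, sub_self]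
      · rw [(hz i hb).2]; rfl
    refine Submodule.mem_sup.2 ⟨φ i z • (x i : U.carrier i).1,
      Submodule.smul_mem _ _ (Submodule.mem_span_singleton_self _),
      _, ⟨z - φ i z • x i, hker, rfl⟩, ?_⟩
    exact add_sub_cancel _ _
  · intro i hi hb
    have hc := hc i
    rw [link_of_true _ hi] at hc
    exact congrArg Subtype.val (hc.1 hb)
  · intro i hi hb
    have hc := hc i
    rw [link_of_false _ hi] at hc
    exact congrArg Subtype.val (hc.1 hb)

end Subrep

/-! ### The decomposition -/

theorem intervalFiber_eq_zero {P : Prop} (hP : ¬ P) (c : intervalFiber 𝔽 P) : c = 0 := by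
  have h : intervalFiber 𝔽 P = ⊥ := if_neg hP
  exact Subtype.ext ((Submodule.mem_bot 𝔽).1 (h ▸ c.2))

/-- The linear map from a direct sum of fibres of interval modules that sends the generator of the
`j`-th summand to `x j`. -/
noncomputable def intervalSum (𝔽 : Type u) [Field 𝔽] {J : Type w} [DecidableEq J] {E : Type v}
    [AddCommGroup E] [Module 𝔽 E] (P : J → Prop) (x : J → E) :
    (DirectSum J fun j => intervalFiber 𝔽 (P j)) →ₗ[𝔽] E :=
  DirectSum.toModule 𝔽 J E fun j =>
    (LinearMap.toSpanSingleton 𝔽 E (x j)).comp (intervalFiber 𝔽 (P j)).subtype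

theorem intervalSum_lof {J : Type w} [DecidableEq J] {E : Type v} [AddCommGroup E] [Module 𝔽 E]
    {P : J → Prop} {x : J → E} (j : J) (c : intervalFiber 𝔽 (P j)) :
    intervalSum 𝔽 P x (DirectSum.lof 𝔽 J (fun j => intervalFiber 𝔽 (P j)) j c) = c.1 • x j := by
  rw [intervalSum, DirectSum.toModule_lof]
  rfl

/-- If the subspaces `U k` descend from `⊤` to `⊥`, and each step at `k ∈ J` splits off the span of
`x k` while the other steps are trivial, then the `x k` with `P k` form a basis. The
proposition `P k` says whether `x k` is nonzero. -/
theorem bijective_of_filtration {E : Type v} [AddCommGroup E] [Module 𝔽 E]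
    (U : ℕ → Submodule 𝔽 E) (hU : Antitone U) (h0 : U 0 = ⊤) (K : ℕ) (hK : U K = ⊥) (J : Set ℕ)
    (x : J → E) (P : J → Prop) (hmem : ∀ j : J, x j ∈ U j)
    (hnot : ∀ j : J, P j → x j ∉ U (j + 1))
    (hsup : ∀ j : J, U j ≤ Submodule.span 𝔽 {x j} ⊔ U (j + 1)) (hz : ∀ j : J, ¬ P j → x j = 0)
    (htriv : ∀ k ∉ J, U (k + 1) = U k) :
    Function.Bijective (intervalSum 𝔽 P x) := by
  constructor
  · refine (injective_iff_map_eq_zero _).2 fun e he => ?_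
    by_contra hne
    -- The first index with a nonzero coefficient gives a contradiction modulo the next subspace.
    have hex : ∃ j, e j ≠ 0 := by
      by_contra! hcon
      exact hne (DFinsupp.ext hcon)
    classical
    obtain ⟨j, hj, hmin⟩ := WellFounded.has_min (wellFounded_lt (α := J)) {j | e j ≠ 0} hex
    have hPj : P j := by
      by_contra hP
      exact hj (intervalFiber_eq_zero hP _)
    have hcj : (e j).1 ≠ 0 := fun h => hj (Subtype.ext h)
    have hsum : intervalSum 𝔽 P x e = ∑ i ∈ DFinsupp.support e, (e i).1 • x i := by
      conv_lhs => rw [← DirectSum.sum_support_of e, map_sum]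
      exact Finset.sum_congr rfl fun i _ => intervalSum_lof i (e i)
    have hjs : j ∈ DFinsupp.support e := DFinsupp.mem_support_iff.2 hj
    rw [he, ← Finset.add_sum_erase _ _ hjs] at hsum
    refine hnot j hPj ((Submodule.smul_mem_iff _ hcj).1 ?_)
    rw [eq_neg_of_add_eq_zero_left hsum.symm]
    refine Submodule.neg_mem _ (Submodule.sum_mem _ fun i hi => Submodule.smul_mem _ _ ?_)
    obtain ⟨hij, his⟩ := Finset.mem_erase.1 hi
    have hji : j < i := lt_of_le_of_ne
      (not_lt.1 (hmin i (DFinsupp.mem_support_iff.1 his))) (Ne.symm hij)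
    exact hU (Nat.succ_le_of_lt hji) (hmem i)
  · have hx : ∀ j : J, x j ∈ LinearMap.range (intervalSum 𝔽 P x) := fun j => by
      by_cases hP : P j
      · refine ⟨DirectSum.lof 𝔽 J (fun j => intervalFiber 𝔽 (P j)) j
          ⟨1, by rw [intervalFiber, if_pos hP]; trivial⟩, ?_⟩
        rw [intervalSum_lof, one_smul]
      · rw [hz j hP]; exact zero_mem _
    have hk : ∀ k, ⊤ ≤ LinearMap.range (intervalSum 𝔽 P x) ⊔ U k := fun k => by
      induction k with
      | zero => rw [h0]; exact le_sup_right
      | succ k ih =>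
        refine ih.trans (sup_le le_sup_left ?_)
        by_cases hkJ : k ∈ J
        · refine (hsup ⟨k, hkJ⟩).trans (sup_le_sup_right ?_ _)
          exact (Submodule.span_singleton_le_iff_mem _ _).2 (hx _)
        · rw [htriv k hkJ]; exact le_sup_right
    have := hk K
    rw [hK, sup_bot_eq] at this
    exact LinearMap.range_eq_top.1 (top_le_iff.1 this)

theorem smul_intervalMap {E F : Type v} [AddCommGroup E] [Module 𝔽 E] [AddCommGroup F] [Module 𝔽 F]
    (f : E →ₗ[𝔽] F) {P Q : Prop} {x : E} {y : F} (h : P → f x = y) (hy : ¬ Q → y = 0)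
    (c : intervalFiber 𝔽 P) : (intervalMap 𝔽 P Q c).1 • y = f (c.1 • x) := by
  by_cases hP : P
  · by_cases hQ : Q
    · rw [map_smul, h hP, intervalMap, dif_pos ⟨hP, hQ⟩]; rfl
    · rw [map_smul, h hP, hy hQ, smul_zero, smul_zero]
  · rw [intervalFiber_eq_zero hP c, map_zero, Submodule.coe_zero, Submodule.coe_zero, zero_smul,
      zero_smul, map_zero]

theorem intervalSum_lmap {J : Type w} [DecidableEq J] {E F : Type v} [AddCommGroup E] [Module 𝔽 E]
    [AddCommGroup F] [Module 𝔽 F] (f : E →ₗ[𝔽] F) {P Q : J → Prop} {x : J → E} {y : J → F}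
    (h : ∀ j, P j → f (x j) = y j) (hy : ∀ j, ¬ Q j → y j = 0)
    (c : DirectSum J fun j => intervalFiber 𝔽 (P j)) :
    intervalSum 𝔽 Q y (DirectSum.lmap (fun j => intervalMap 𝔽 (P j) (Q j)) c) =
      f (intervalSum 𝔽 P x c) := by
  have key : intervalSum 𝔽 Q y ∘ₗ DirectSum.lmap (fun j => intervalMap 𝔽 (P j) (Q j)) =
      f ∘ₗ intervalSum 𝔽 P x := by
    refine DirectSum.linearMap_ext 𝔽 fun j => LinearMap.ext fun c => ?_
    rw [LinearMap.comp_apply, LinearMap.comp_apply, LinearMap.comp_apply, LinearMap.comp_apply,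
      DirectSum.lmap_lof, intervalSum_lof, intervalSum_lof]
    exact smul_intervalMap f (h j) (hy j) c
  exact LinearMap.congr_fun key c

/-- A sequence of integers that takes each value infinitely often. -/
theorem exists_recurrent_seq : ∃ e : ℕ → ℤ, ∀ i K, ∃ k, K ≤ k ∧ e k = i :=
  ⟨fun k => Equiv.intEquivNat.symm k.unpair.1, fun i K =>
    ⟨Nat.pair (Equiv.intEquivNat i) K, Nat.right_le_pair _ _, by simp⟩⟩

theorem symm_apply_comm {E F G H : Type*} [AddCommGroup E] [Module 𝔽 E] [AddCommGroup F]
    [Module 𝔽 F] [AddCommGroup G] [Module 𝔽 G] [AddCommGroup H] [Module 𝔽 H] (e : E ≃ₗ[𝔽] F)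
    (e' : G ≃ₗ[𝔽] H) {g : E →ₗ[𝔽] G} {f : F →ₗ[𝔽] H} (h : ∀ c, e' (g c) = f (e c)) (y : F) :
    e'.symm (f y) = g (e.symm y) := by
  rw [LinearEquiv.symm_apply_eq, h, LinearEquiv.apply_symm_apply]

/-- Intervals are split off one after the other from the successive complements. The step at `k`
takes care of the index `e k`, for a sequence `e` that visits every index infinitely often, so the
dimension of the complement at each index falls to zero after finitely many steps. -/
theorem exists_iso_directSum_interval (V : ZigzagModule.{u, v} 𝔽 o) (hfin : V.LocallyFinite)
    (hne : V.IsNonzero) :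
    ∃ (ι : Type) (a b : ι → ExtInt), Nonempty ι ∧ (∀ j, a j ≤ b j ∧ a j ≠ ⊤ ∧ b j ≠ ⊥) ∧
      Nonempty (Iso V (directSum fun j => interval 𝔽 o (a j) (b j))) := by
  have : ∀ i, FiniteDimensional 𝔽 (V.obj i) := hfin
  obtain ⟨e, he⟩ := exists_recurrent_seq
  -- At step `k`, split off an interval containing `e k` if there is one, else do nothing.
  have hstep : ∀ (U : V.Subrep) (k : ℕ), ∃ (U' : V.Subrep) (a b : ExtInt) (x : ∀ i, V.obj i),
      (U.carrier (e k) ≠ ⊥ → Between a b (e k) ∧ U.Splits U' a b x) ∧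
      (U.carrier (e k) = ⊥ → U' = U) := fun U k => by
    by_cases h : U.carrier (e k) = ⊥
    · exact ⟨U, ⊥, ⊤, 0, fun h' => (h' h).elim, fun _ => rfl⟩
    · obtain ⟨U', a, b, x, hx⟩ := U.exists_splits hfin (e k) h
      exact ⟨U', a, b, x, fun _ => hx, fun h' => (h h').elim⟩
  choose next a b x hs ht using hstep
  let top : V.Subrep := ⟨fun _ => ⊤, fun _ _ _ _ => trivial, fun _ _ _ _ => trivial⟩
  let U : ℕ → V.Subrep := fun k => Nat.rec top (fun k U => next U k) k
  let J : Set ℕ := {k | (U k).carrier (e k) ≠ ⊥}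
  have hJ : ∀ j : J, Between (a (U j) j) (b (U j) j) (e j) ∧
      (U j).Splits (U (j + 1)) (a (U j) j) (b (U j) j) (x (U j) j) := fun j => hs (U j) j j.2
  have htriv : ∀ k ∉ J, U (k + 1) = U k := fun k hk => ht (U k) k (not_not.1 hk)
  have hanti : ∀ i, Antitone fun k => (U k).carrier i := fun i =>
    antitone_nat_of_succ_le fun k => by
      by_cases hk : k ∈ J
      · exact (hJ ⟨k, hk⟩).2.le i
      · rw [htriv k hk]
  have hbot : ∀ i, ∃ K, (U K).carrier i = ⊥ := fun i => by
    obtain ⟨K, hK⟩ := exists_iInf_eq_of_antitone (hanti i)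
    obtain ⟨k, hk, rfl⟩ := he i K
    refine ⟨k, by_contra fun hkJ => ?_⟩
    obtain ⟨hb, hsp⟩ := hJ ⟨k, hkJ⟩
    have hle : (U k).carrier (e k) ≤ (U (k + 1)).carrier (e k) :=
      (hanti _ hk).trans (hK.ge.trans (iInf_le _ (k + 1)))
    exact hsp.notMem _ hb (hle (hsp.mem _))
  have hbij : ∀ i, Function.Bijective (intervalSum 𝔽
      (fun j : J => Between (a (U j) j) (b (U j) j) i) fun j => x (U j) j i) := fun i => by
    obtain ⟨K, hK⟩ := hbot i
    exact bijective_of_filtration (fun k => (U k).carrier i) (hanti i) rfl K hK J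
      (fun j => x (U j) j i) (fun j => Between (a (U j) j) (b (U j) j) i)
      (fun j => (hJ j).2.mem i) (fun j => (hJ j).2.notMem i) (fun j => (hJ j).2.le_sup i)
      (fun j => (hJ j).2.eq_zero i) (fun k hk => by rw [htriv k hk])
  refine ⟨J, fun j => a (U j) j, fun j => b (U j) j, ?_, fun j => (hJ j).1.endpoints, ?_⟩
  · obtain ⟨i, hi⟩ := hne
    by_contra hempty
    obtain ⟨K, hK⟩ := hbot i
    have hU : ∀ k, U k = top := fun k => by
      induction k with
      | zero => rfl
      | succ k ih => rw [htriv k fun hk => hempty ⟨⟨k, hk⟩⟩, ih]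
    rw [hU] at hK
    exact top_ne_bot hK
  · exact ⟨⟨fun i => (LinearEquiv.ofBijective _ (hbij i)).symm,
      fun i h => symm_apply_comm _ _ (intervalSum_lmap (V.fwd i h)
        (fun j => (hJ j).2.fwd_eq i h) fun j => (hJ j).2.eq_zero (i + 1)),
      fun i h => symm_apply_comm _ _ (intervalSum_lmap (V.bwd i h)
        (fun j => (hJ j).2.bwd_eq i h) fun j => (hJ j).2.eq_zero i)⟩⟩

end ZigzagModule

theorem mainTheorem2 {𝔽 : Type u} [Field 𝔽] (o : ZigzagOrientation)
    (V : ZigzagModule.{u, v} 𝔽 o) (hfin : V.LocallyFinite) (hne : V.IsNonzero) :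
    ∃ (ι : Type) (a b : ι → ZigzagModule.ExtInt),
      Nonempty ι ∧
      (∀ j, a j ≤ b j ∧ a j ≠ ⊤ ∧ b j ≠ ⊥) ∧
      Nonempty (ZigzagModule.Iso V
        (ZigzagModule.directSum fun j => ZigzagModule.interval 𝔽 o (a j) (b j))) :=
  ZigzagModule.exists_iso_directSum_interval V hfin hne
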